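/- Theorem 2. A measure preserving system $(X,\mathcal B,\mu,T)$ is a probability space with an invertible (bijective, measurable in both directions) measure preserving transformation $T$. For $1\le r\le\infty$, say that the Return Times for the Tail Property holds in $L^r(\mu)$ for $(X,\mathcal B,\mu,T)$ if for each $f\in L^r(\mu)$ there is a set $X_f\subseteq X$ of full $\mu$-measure such that for all $x\in X_f$, for all measure preserving systems $(Y,\mathcal G,\nu,S)$ and each $g\in L^1(\nu)$, $$\frac{f(T^nx)\,g(S^ny)}{n}\longrightarrow 0\quad (n\to\infty)\qquad\text{for }\nu\text{-a.e. }y\in Y.$$ The Return Times for the Tail Property does not hold in general for $r=1$: there exist a measure preserving system $(X,\mathcal B,\mu,T)$ and a real-valued $f\in L^1(\mu)$ for which there is no set $X_f$ of full $\mu$-measure as above. -/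

import Mathlib

open MeasureTheory Filter Topology
open scoped ENNReal

/-- The Return Times for the Tail Property in `L^r(μ)` (for `1 ≤ r ≤ ∞`) of the invertible
probability measure preserving system `(X, μ, T)`: for every `f ∈ L^r(μ)` there is a set of full
`μ`-measure such that, for every `x` in it, every invertible probability measure preserving system
`(Y, ν, S)` and every `g ∈ L^1(ν)`, one has `f (T^n x) * g (S^n y) / n → 0` for `ν`-a.e. `y`.
The exceptional set depends only on `f`. -/
def ReturnTimesForTheTail {X : Type} [MeasurableSpace X] (μ : Measure X) (T : X ≃ᵐ X)
    (r : ℝ≥0∞) : Prop :=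
  ∀ f : X → ℝ, MemLp f r μ →
    ∀ᵐ x ∂μ, ∀ (Y : Type) [MeasurableSpace Y] (ν : Measure Y) [IsProbabilityMeasure ν]
      (S : Y ≃ᵐ Y), MeasurePreserving S ν ν →
      ∀ g : Y → ℝ, Integrable g ν →
        ∀ᵐ y ∂ν, Tendsto (fun n : ℕ => f (T^[n] x) * g (S^[n] y) / (n : ℝ)) atTop (𝓝 0)

/-! Write `a n = f (T^n x)`. If `#{n : a n ≥ n / s} / s` is unbounded in `s`, a Bernoulli shift
defeats these weights (`exists_system_not_tendsto`). Take `g` of one coordinate with tail at least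
`1 / N j` at level `s j`, where `N j ≥ 2 ^ j * s j` counts such `n`. As `∑ s j / N j` converges, `g`
can be integrable, yet `N j` independent trials succeed somewhere with probability at least `1 -
1/e`, and a success at `n` makes the quotient at least 1.

So an integrable `f` is needed whose counts are unbounded on a set of positive measure. It is a
weighted sum, over a product of cyclic rotations, of the periodic functions of
`exists_periodic_large_count`. Those come from making the loss, the mean of `exp (-#A / t)`, small
at mean one. `HasTowers.combine` puts an old tower on half a period and sparse but very high points
on the other half; these add hits for most points of the first half at their own times. Then `n`
rounds cost `2^-n` in mean, but all contribute equally and multiply the loss by about `1 - n * 2^-n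
/ 8`. After `2^n` repetitions the mean is at most 1 and the loss at most `24 / n`. -/

/-! ### Sums of periodic functions -/

lemma Function.Periodic.sum_range_add_eq {h : ℕ → ℝ} {P : ℕ} (hh : Function.Periodic h P) (a : ℕ) :
    ∑ i ∈ Finset.range P, h (a + i) = ∑ i ∈ Finset.range P, h i := by
  induction a with
  | zero => simp
  | succ a ih =>
    rw [← ih]
    have h1 := Finset.sum_range_succ (fun i => h (a + i)) P
    have h2 := Finset.sum_range_succ' (fun i => h (a + i)) P
    have h3 : h (a + P) = h (a + 0) := hh a
    simp only [← add_assoc] at h2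
    simp only [add_right_comm a 1]
    linarith

lemma Function.Periodic.sum_range_mul_eq {h : ℕ → ℝ} {P : ℕ} (hh : Function.Periodic h P)
    (q a : ℕ) :
    ∑ i ∈ Finset.range (q * P), h (a + i) = q * ∑ i ∈ Finset.range P, h i := by
  induction q with
  | zero => simp
  | succ q ih =>
    rw [Nat.succ_mul, Finset.sum_range_add, ih]
    simp only [← add_assoc]
    rw [hh.sum_range_add_eq]
    push_cast
    ring

/-! ### Towers and their splicing -/

/-- `f` is a `2 ^ r`-periodic function bounded by `2 ^ C`, of mean at most `m`, for which the set
`{c ≤ f}` has density at least `d`. Every `x < 2 ^ r` comes with a time `t x` of order `2 ^ r` and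
a finite set `A x` of indices `n` satisfying `f (x + n) ≥ n / t x`, such that the mean of
`exp (- #(A x) / t x)` is at most `α`. -/
structure IsTower (c C r : ℕ) (d m α : ℝ) (f : ℕ → ℕ) : Prop where
  periodic : Function.Periodic f (2 ^ r)
  le_pow : ∀ x, f x ≤ 2 ^ C
  mean_le : ∑ x ∈ Finset.range (2 ^ r), (f x : ℝ) ≤ m * 2 ^ r
  density_ge : d * 2 ^ r ≤ ∑ x ∈ Finset.range (2 ^ r), (if c ≤ f x then (1 : ℝ) else 0)
  exists_hits : ∃ (t : ℕ → ℕ) (A : ℕ → Finset ℕ),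
    (∀ x < 2 ^ r, 2 ^ r ≤ 2 ^ C * t x ∧ t x ≤ 2 ^ (r + C) ∧
      ∀ n ∈ A x, 1 ≤ n ∧ n ≤ t x * f (x + n)) ∧
    ∑ x ∈ Finset.range (2 ^ r), Real.exp (-((A x).card / (t x : ℝ))) ≤ α * 2 ^ r

/-- Towers with the given parameters exist at all scales `2 ^ r`, with a uniform constant `C`. -/
def HasTowers (c C : ℕ) (d m α : ℝ) : Prop :=
  ∀ r, C ≤ r → ∃ f, IsTower c C r d m α f

lemma HasTowers.mono {c C : ℕ} {d m α m' α' : ℝ} (h : HasTowers c C d m α)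
    (hm : m ≤ m') (hα : α ≤ α') : HasTowers c C d m' α' := by
  intro r hr
  obtain ⟨f, h1, h2, h3, h4, t, A, h5, h6⟩ := h r hr
  exact ⟨f, h1, h2, h3.trans (by gcongr), h4, t, A, h5, h6.trans (by gcongr)⟩

lemma HasTowers.density_zero {c C : ℕ} {d m α : ℝ} (h : HasTowers c C d m α) (c' : ℕ) :
    HasTowers c' C 0 m α := by
  intro r hr
  obtain ⟨f, h1, h2, h3, -, h5⟩ := h r hr
  refine ⟨f, h1, h2, h3, ?_, h5⟩
  rw [zero_mul]
  exact Finset.sum_nonneg fun x _ => by split_ifs <;> simp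

lemma hasTowers_zero : HasTowers 0 0 0 0 1 := by
  intro r _
  refine ⟨0, fun x => rfl, fun x => by simp, by simp, by simp, fun _ => 2 ^ r, fun _ => ∅,
    fun x _ => by simp, by simp⟩

/-- The seed of the iteration: it claims no hits and only supplies high points. -/
lemma hasTowers_multiples (γ : ℕ) : HasTowers (2 ^ γ) γ ((1 / 2) ^ γ) 1 1 := by
  intro r hr
  obtain ⟨k, rfl⟩ := Nat.exists_eq_add_of_le hr
  have hper : Function.Periodic (fun x : ℕ => if 2 ^ γ ∣ x then (1 : ℝ) else 0) (2 ^ γ) := by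
    intro x
    simp
  have hone : ∑ x ∈ Finset.range (2 ^ γ), (if 2 ^ γ ∣ x then (1 : ℝ) else 0) = 1 := by
    rw [Finset.sum_eq_single_of_mem 0 (by simp)]
    · simp
    · intro b hb hb0
      rw [if_neg]
      intro hd
      exact hb0 (Nat.eq_zero_of_dvd_of_lt hd (Finset.mem_range.1 hb))
  have hsum : ∑ x ∈ Finset.range (2 ^ (γ + k)), (if 2 ^ γ ∣ x then (1 : ℝ) else 0) = 2 ^ k := by
    have := hper.sum_range_mul_eq (2 ^ k) 0
    rw [hone, ← pow_add, add_comm k] at this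
    simpa using this
  refine ⟨fun x => if 2 ^ γ ∣ x then 2 ^ γ else 0, ?_, ?_, ?_, ?_, fun _ => 2 ^ (γ + k),
    fun _ => ∅, fun x _ => ⟨?_, ?_, by simp⟩, by simp⟩
  · intro x
    have : 2 ^ γ ∣ 2 ^ (γ + k) := pow_dvd_pow _ (by omega)
    simp only [(Nat.dvd_add_iff_left this).symm]
  · intro x
    split_ifs <;> simp
  · have : ∀ x : ℕ, (((if 2 ^ γ ∣ x then 2 ^ γ else 0 : ℕ)) : ℝ)
        = 2 ^ γ * (if 2 ^ γ ∣ x then (1 : ℝ) else 0) := by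
      intro x; split_ifs <;> simp
    simp only [this]
    rw [← Finset.mul_sum, hsum, pow_add, one_mul]
  · have : ∀ x : ℕ, (if 2 ^ γ ≤ (if 2 ^ γ ∣ x then 2 ^ γ else 0) then (1 : ℝ) else 0)
        = (if 2 ^ γ ∣ x then (1 : ℝ) else 0) := by
      intro x
      by_cases h : 2 ^ γ ∣ x <;> simp [h]
    simp only [this]
    rw [hsum, pow_add, ← mul_assoc, ← mul_pow]
    norm_num
  · exact Nat.le_mul_of_pos_left _ (by positivity)
  · exact Nat.pow_le_pow_right (by norm_num) (by omega)

/-- The `2 * H`-periodic function that follows `f` on `[0, H)` and `g` on `[H, 2 * H)`. -/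
def splice (H : ℕ) (f g : ℕ → ℕ) (x : ℕ) : ℕ :=
  if x % (2 * H) < H then f x else g x

lemma splice_periodic {H P Q a b : ℕ} {f g : ℕ → ℕ} (hf : Function.Periodic f P)
    (hg : Function.Periodic g Q) (hP : H = a * P) (hQ : H = b * Q) :
    Function.Periodic (splice H f g) (2 * H) := by
  intro x
  have h1 : f (x + 2 * H) = f x := by
    have := (hf.nat_mul (2 * a)) x
    rwa [Nat.cast_id, show ((2 * a : ℕ) * P) = 2 * H by rw [hP]; ring] at this
  have h2 : g (x + 2 * H) = g x := by
    have := (hg.nat_mul (2 * b)) x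
    rwa [Nat.cast_id, show ((2 * b : ℕ) * Q) = 2 * H by rw [hQ]; ring] at this
  simp [splice, h1, h2]

lemma splice_of_lt {H x : ℕ} (f g : ℕ → ℕ) (hx : x < H) : splice H f g x = f x := by
  rw [splice, Nat.mod_eq_of_lt (by omega), if_pos hx]

lemma splice_of_ge {H x : ℕ} (f g : ℕ → ℕ) (hx : H ≤ x) (hx2 : x < 2 * H) :
    splice H f g x = g x := by
  rw [splice, Nat.mod_eq_of_lt hx2, if_neg (by omega)]

lemma sum_splice {H P Q a b : ℕ} {f g : ℕ → ℕ} (hf : Function.Periodic f P)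
    (hg : Function.Periodic g Q) (hP : H = a * P) (hQ : H = b * Q) (φ : ℕ → ℝ) :
    ∑ x ∈ Finset.range (2 * H), φ (splice H f g x) =
      a * ∑ x ∈ Finset.range P, φ (f x) + b * ∑ x ∈ Finset.range Q, φ (g x) := by
  have h1 : Function.Periodic (fun x => φ (f x)) P := fun x => by simp only [hf x]
  have h2 : Function.Periodic (fun x => φ (g x)) Q := fun x => by simp only [hg x]
  rw [two_mul, Finset.sum_range_add, ← h1.sum_range_mul_eq a 0, ← h2.sum_range_mul_eq b H,
    ← hP, ← hQ]
  congr 1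
  · refine Finset.sum_congr rfl fun x hx => ?_
    rw [splice_of_lt f g (Finset.mem_range.1 hx), zero_add]
  · refine Finset.sum_congr rfl fun x hx => ?_
    have := Finset.mem_range.1 hx
    rw [splice_of_ge f g (by omega) (by omega)]

/-- If `{x ∈ [H, 2 * H) | c ≤ f x}` has at least `D` elements, then any window of length
`t * c ≥ 2 * H` meets the periodic extension of that set proportionally often. -/
lemma exists_far_hits {c t H : ℕ} {f : ℕ → ℕ} {D : ℝ} (hf : Function.Periodic f (2 * H))
    (hH : 0 < H) (hct : 2 * H ≤ t * c) (hD0 : 0 ≤ D)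
    (hD : D ≤ ∑ x ∈ Finset.range (2 * H), (if H ≤ x % (2 * H) ∧ c ≤ f x then (1 : ℝ) else 0))
    (x : ℕ) :
    ∃ A : Finset ℕ, (∀ n ∈ A, 1 ≤ n ∧ n ≤ t * c ∧ c ≤ f (x + n) ∧ H ≤ (x + n) % (2 * H)) ∧
      D * (t * c) / (4 * H) ≤ A.card := by
  set q := t * c / (2 * H) with hq
  have hq1 : q * (2 * H) ≤ t * c := Nat.div_mul_le_self _ _
  -- Rounding the window down to whole periods loses at most a factor 2, whence `4 * H` instead of
  -- `2 * H`.
  have hq2 : t * c ≤ 2 * (q * (2 * H)) := by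
    have h1 : t * c < (q + 1) * (2 * H) := by
      have h3 := Nat.div_add_mod (t * c) (2 * H)
      have h4 := Nat.mod_lt (t * c) (show 0 < 2 * H by omega)
      rw [← hq] at h3
      nlinarith
    have h2 : 1 ≤ q := (Nat.one_le_div_iff (by omega)).2 hct
    nlinarith
  have hper : Function.Periodic
      (fun x => if H ≤ x % (2 * H) ∧ c ≤ f x then (1 : ℝ) else 0) (2 * H) := by
    intro y
    simp [hf y]
  have hsum := hper.sum_range_mul_eq q (x + 1)
  refine ⟨((Finset.range (q * (2 * H))).filter
    (fun i => H ≤ (x + 1 + i) % (2 * H) ∧ c ≤ f (x + 1 + i))).image (fun i => 1 + i), ?_, ?_⟩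
  · intro n hn
    simp only [Finset.mem_image, Finset.mem_filter, Finset.mem_range] at hn
    obtain ⟨i, ⟨hi, h1, h2⟩, rfl⟩ := hn
    rw [← add_assoc]
    exact ⟨by omega, by omega, h2, h1⟩
  · rw [Finset.card_image_of_injective _ (add_right_injective 1), Finset.natCast_card_filter, hsum]
    have hHR : (0 : ℝ) < H := by exact_mod_cast hH
    have hq3 : (t * c : ℝ) ≤ 2 * (q * (2 * H)) := by exact_mod_cast hq2
    calc D * (t * c) / (4 * H) ≤ D * (2 * (q * (2 * H))) / (4 * H) := by gcongr
      _ = q * D := by field_simp; ring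
      _ ≤ _ := by gcongr

lemma sum_range_boundary_le (H W : ℕ) :
    ∑ x ∈ Finset.range H, (if H ≤ x + W then (1 : ℝ) else 0) ≤ W := by
  rw [← Finset.natCast_card_filter]
  have : (Finset.range H).filter (fun x => H ≤ x + W) ⊆ Finset.Ico (H - W) H := by
    intro x hx
    simp only [Finset.mem_filter, Finset.mem_range] at hx
    simp only [Finset.mem_Ico]
    omega
  have h2 := Finset.card_le_card this
  rw [Nat.card_Ico] at h2
  exact_mod_cast h2.trans (by omega)

lemma sum_range_mod {P H a : ℕ} (hP : H = a * P) (φ : ℕ → ℝ) :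
    ∑ x ∈ Finset.range H, φ (x % P) = a * ∑ x ∈ Finset.range P, φ x := by
  have h1 : Function.Periodic (fun x => φ (x % P)) P := fun x => by simp
  have := h1.sum_range_mul_eq a 0
  simp only [zero_add, ← hP] at this
  rw [this]
  congr 1
  exact Finset.sum_congr rfl fun x hx => by rw [Nat.mod_eq_of_lt (Finset.mem_range.1 hx)]

lemma two_pow_le_of_scale {C r k K R t : ℕ} (ht : 2 ^ r ≤ 2 ^ C * t) (hR : R = k + r)
    (hK : k + C ≤ K) : 2 ^ R ≤ 2 ^ K * t := by
  calc 2 ^ R = 2 ^ k * 2 ^ r := by rw [hR, pow_add]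
    _ ≤ 2 ^ k * (2 ^ C * t) := by gcongr
    _ = 2 ^ (k + C) * t := by rw [pow_add]; ring
    _ ≤ 2 ^ K * t := by gcongr; norm_num

lemma hit_le_window {C r W t n : ℕ} {f : ℕ → ℕ} {z : ℕ} (ht : t ≤ 2 ^ (r + C))
    (hf : ∀ x, f x ≤ 2 ^ C) (hn : n ≤ t * f z) (hW : W = 2 ^ (r + 2 * C)) : n ≤ W := by
  calc n ≤ t * f z := hn
    _ ≤ 2 ^ (r + C) * 2 ^ C := Nat.mul_le_mul ht (hf z)
    _ = W := by rw [hW, ← pow_add]; congr 1; ring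

lemma periodic_mod_add {f : ℕ → ℕ} {P : ℕ} (hf : Function.Periodic f P) (x n : ℕ) :
    f (x % P + n) = f (x + n) := by
  rw [← hf.map_mod_nat (x % P + n), ← hf.map_mod_nat (x + n), Nat.mod_add_mod]

/-- A first-half point keeps its time `t` and its old hits. Since `t * 2 ^ γ` exceeds the period, it
also sees high points of the second half, which add `2 ^ γ * d / 4` to `#A / t`. The two kinds of
hits lie in different halves, so they are disjoint. Second-half points keep their hits; points near
the end of either half lose theirs, which costs the term in `h`. -/
theorem HasTowers.combine {c' CA CB γ h : ℕ} {d m α m' β : ℝ} (hA : HasTowers c' CA 0 m α)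
    (hB : HasTowers (2 ^ γ) CB d m' β) (hd : 0 ≤ d) (hh : 1 ≤ h) (hγ : 3 * CA + h ≤ γ) :
    HasTowers (2 ^ γ) (3 * (CA + CB) + h + 1) (d / 2) ((m + m') / 2)
      ((Real.exp (-(2 ^ γ * d / 4)) * α + β) / 2 + 2 * (1 / 2) ^ h) := by
  intro R hR
  -- Inner scales are chosen so that old hits reach at most `W = 2 ^ (R - h)` ahead, a small
  -- fraction of a half period.
  obtain ⟨rA, hrA⟩ := Nat.exists_eq_add_of_le (show 2 * CA + h ≤ R by omega)
  obtain ⟨rB, hrB⟩ := Nat.exists_eq_add_of_le (show 2 * CB + h ≤ R by omega)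
  obtain ⟨f, hf⟩ := hA rA (by omega)
  obtain ⟨g, hg⟩ := hB rB (by omega)
  obtain ⟨t, A, htA, hlossA⟩ := hf.exists_hits
  obtain ⟨s, B, hsB, hlossB⟩ := hg.exists_hits
  set H := 2 ^ (R - 1) with hH
  set W := 2 ^ (R - h) with hW
  have hHpos : 0 < H := by positivity
  have h2H : 2 ^ R = 2 * H := by
    rw [hH, ← pow_succ']; congr 1; omega
  set a := 2 ^ (R - 1 - rA) with ha
  set b := 2 ^ (R - 1 - rB) with hb
  have hPA : H = a * 2 ^ rA := by rw [hH, ha, ← pow_add]; congr 1; omega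
  have hPB : H = b * 2 ^ rB := by rw [hH, hb, ← pow_add]; congr 1; omega
  have hWA : W = 2 ^ (rA + 2 * CA) := by rw [hW]; congr 1; omega
  have hWB : W = 2 ^ (rB + 2 * CB) := by rw [hW]; congr 1; omega
  have hPA' : (a : ℝ) * 2 ^ rA = H := by rw [hPA]; push_cast; ring
  have hPB' : (b : ℝ) * 2 ^ rB = H := by rw [hPB]; push_cast; ring
  have h2H' : (2 : ℝ) ^ R = 2 * H := by exact_mod_cast h2H
  have hHR : (0 : ℝ) < H := by exact_mod_cast hHpos
  have hper := splice_periodic hf.periodic hg.periodic hPA hPB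
  have hdens : d * H ≤ b * ∑ x ∈ Finset.range (2 ^ rB), (if 2 ^ γ ≤ g x then (1 : ℝ) else 0) := by
    rw [← hPB', mul_left_comm]
    have := hg.density_ge
    gcongr
  have hsum := sum_splice hf.periodic hg.periodic hPA hPB
  have hfar : d * H ≤ ∑ x ∈ Finset.range (2 * H),
      (if H ≤ x % (2 * H) ∧ 2 ^ γ ≤ splice H f g x then (1 : ℝ) else 0) := by
    refine hdens.trans ?_
    have hgper : Function.Periodic (fun x => if 2 ^ γ ≤ g x then (1 : ℝ) else 0) (2 ^ rB) :=
      fun x => by simp only [hg.periodic x]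
    rw [← hgper.sum_range_mul_eq b H, ← hPB, two_mul, Finset.sum_range_add]
    refine le_add_of_nonneg_of_le (Finset.sum_nonneg fun x _ => by split_ifs <;> simp)
      (le_of_eq (Finset.sum_congr rfl fun x hx => ?_))
    have := Finset.mem_range.1 hx
    rw [splice_of_ge f g (by omega) (by omega), Nat.mod_eq_of_lt (by omega)]
    simp
  set κ := 2 ^ γ * d / 4 with hκ
  -- The indicator pays the trivial loss 1 for points within `W` of the end of their half.
  set bound : ℕ → ℝ := fun x => if x < H then
      Real.exp (-κ) * Real.exp (-((A (x % 2 ^ rA)).card / (t (x % 2 ^ rA) : ℝ))) +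
        (if H ≤ x + W then (1 : ℝ) else 0)
    else Real.exp (-((B ((x - H) % 2 ^ rB)).card / (s ((x - H) % 2 ^ rB) : ℝ))) +
        (if H ≤ x - H + W then (1 : ℝ) else 0) with hbound
  have key : ∀ x, ∃ (t' : ℕ) (A' : Finset ℕ), x < 2 ^ R →
      (2 ^ R ≤ 2 ^ (3 * (CA + CB) + h + 1) * t' ∧ t' ≤ 2 ^ (R + (3 * (CA + CB) + h + 1)) ∧
        ∀ n ∈ A', 1 ≤ n ∧ n ≤ t' * splice H f g (x + n)) ∧
      Real.exp (-(A'.card / (t' : ℝ))) ≤ bound x := by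
    intro x
    by_cases hxR : x < 2 ^ R
    swap
    · exact ⟨0, ∅, fun h => absurd h hxR⟩
    rw [h2H] at hxR
    by_cases hxH : x < H
    · set y := x % 2 ^ rA with hy
      obtain ⟨ht1, ht2, ht3⟩ := htA y (Nat.mod_lt _ (by positivity))
      have hlo : 2 ^ R ≤ 2 ^ (3 * (CA + CB) + h + 1) * t y :=
        two_pow_le_of_scale ht1 hrA (by omega)
      have hhi : t y ≤ 2 ^ (R + (3 * (CA + CB) + h + 1)) :=
        ht2.trans (Nat.pow_le_pow_right (by norm_num) (by omega))
      by_cases hxW : x + W < H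
      · have hct : 2 * H ≤ t y * 2 ^ γ := by
          rw [← h2H, mul_comm]
          exact two_pow_le_of_scale ht1 hrA (by omega)
        obtain ⟨E, hE1, hE2⟩ := exists_far_hits hper hHpos hct (by positivity) hfar x
        have hnear : ∀ n ∈ A y, x + n < H := by
          intro n hn
          have := hit_le_window ht2 hf.le_pow (ht3 n hn).2 hWA
          omega
        refine ⟨t y, A y ∪ E, fun _ => ⟨⟨hlo, hhi, ?_⟩, ?_⟩⟩
        · intro n hn
          rcases Finset.mem_union.1 hn with hn | hn
          · refine ⟨(ht3 n hn).1, ?_⟩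
            rw [splice_of_lt f g (hnear n hn), ← periodic_mod_add hf.periodic]
            exact (ht3 n hn).2
          · obtain ⟨h1, h2, h3, -⟩ := hE1 n hn
            exact ⟨h1, h2.trans (by gcongr)⟩
        · have hdisj : Disjoint (A y) E := by
            rw [Finset.disjoint_left]
            intro n hn hn'
            have h1 := hnear n hn
            have h2 := (hE1 n hn').2.2.2
            rw [Nat.mod_eq_of_lt (by omega)] at h2
            omega
          have htpos : (0 : ℝ) < t y := by
            have : 0 < t y := Nat.pos_of_ne_zero fun h0 => by rw [h0] at hct; omega
            exact_mod_cast this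
          have hEκ : κ ≤ E.card / (t y : ℝ) := by
            rw [le_div_iff₀ htpos]
            refine le_trans (le_of_eq ?_) hE2
            rw [hκ]
            push_cast
            field_simp
          simp only [hbound, if_pos hxH, Finset.card_union_of_disjoint hdisj]
          rw [if_neg (by omega), add_zero, ← Real.exp_add]
          apply Real.exp_le_exp.2
          push_cast
          rw [add_div]
          linarith
      · refine ⟨t y, ∅, fun _ => ⟨⟨hlo, hhi, by simp⟩, ?_⟩⟩
        simp only [hbound, if_pos hxH]
        rw [if_pos (by omega)]
        simp only [Finset.card_empty, Nat.cast_zero, zero_div, neg_zero, Real.exp_zero]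
        exact le_add_of_nonneg_left (by positivity)
    · obtain ⟨z, rfl⟩ := Nat.exists_eq_add_of_le (not_lt.1 hxH)
      set y := z % 2 ^ rB with hy
      obtain ⟨ht1, ht2, ht3⟩ := hsB y (Nat.mod_lt _ (by positivity))
      have hlo : 2 ^ R ≤ 2 ^ (3 * (CA + CB) + h + 1) * s y :=
        two_pow_le_of_scale ht1 hrB (by omega)
      have hhi : s y ≤ 2 ^ (R + (3 * (CA + CB) + h + 1)) :=
        ht2.trans (Nat.pow_le_pow_right (by norm_num) (by omega))
      by_cases hxW : z + W < H
      · refine ⟨s y, B y, fun _ => ⟨⟨hlo, hhi, ?_⟩, ?_⟩⟩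
        · intro n hn
          have hnW := hit_le_window ht2 hg.le_pow (ht3 n hn).2 hWB
          refine ⟨(ht3 n hn).1, ?_⟩
          rw [splice_of_ge f g (by omega) (by omega), ← periodic_mod_add hg.periodic, hPB,
            Nat.mul_add_mod_self_right]
          exact (ht3 n hn).2
        · simp only [hbound, if_neg hxH, Nat.add_sub_cancel_left]
          rw [if_neg (by omega), add_zero]
      · refine ⟨s y, ∅, fun _ => ⟨⟨hlo, hhi, by simp⟩, ?_⟩⟩
        simp only [hbound, if_neg hxH, Nat.add_sub_cancel_left]
        rw [if_pos (by omega)]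
        simp only [Finset.card_empty, Nat.cast_zero, zero_div, neg_zero, Real.exp_zero]
        exact le_add_of_nonneg_left (by positivity)
  choose t' A' hkey using key
  refine ⟨splice H f g, ?_, ?_, ?_, ?_, t', A', fun x hx => (hkey x hx).1, ?_⟩
  · rw [h2H]; exact hper
  · intro x
    unfold splice
    split_ifs
    · exact (hf.le_pow x).trans (Nat.pow_le_pow_right (by norm_num) (by omega))
    · exact (hg.le_pow x).trans (Nat.pow_le_pow_right (by norm_num) (by omega))
  · rw [h2H, hsum (fun n => (n : ℝ)), h2H']
    have h1 := mul_le_mul_of_nonneg_left hf.mean_le (Nat.cast_nonneg a)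
    have h2 := mul_le_mul_of_nonneg_left hg.mean_le (Nat.cast_nonneg b)
    rw [mul_left_comm, hPA'] at h1
    rw [mul_left_comm, hPB'] at h2
    linarith
  · rw [h2H, hsum (fun n => if 2 ^ γ ≤ n then (1 : ℝ) else 0), h2H']
    refine le_add_of_nonneg_of_le (mul_nonneg (Nat.cast_nonneg a)
      (Finset.sum_nonneg fun x _ => by split_ifs <;> simp)) (le_trans (le_of_eq ?_) hdens)
    ring
  · calc ∑ x ∈ Finset.range (2 ^ R), Real.exp (-((A' x).card / (t' x : ℝ)))
        ≤ ∑ x ∈ Finset.range (2 ^ R), bound x :=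
          Finset.sum_le_sum fun x hx => (hkey x (Finset.mem_range.1 hx)).2
      _ = (Real.exp (-κ) * (a * ∑ x ∈ Finset.range (2 ^ rA),
            Real.exp (-((A x).card / (t x : ℝ)))) +
            ∑ x ∈ Finset.range H, (if H ≤ x + W then (1 : ℝ) else 0)) +
          (b * ∑ x ∈ Finset.range (2 ^ rB), Real.exp (-((B x).card / (s x : ℝ))) +
            ∑ x ∈ Finset.range H, (if H ≤ x + W then (1 : ℝ) else 0)) := by
          rw [h2H, two_mul, Finset.sum_range_add]
          congr 1
          · rw [← sum_range_mod hPA (fun y => Real.exp (-((A y).card / (t y : ℝ)))),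
              Finset.mul_sum, ← Finset.sum_add_distrib]
            refine Finset.sum_congr rfl fun x hx => ?_
            simp only [hbound, if_pos (Finset.mem_range.1 hx)]
          · rw [← sum_range_mod hPB (fun y => Real.exp (-((B y).card / (s y : ℝ)))),
              ← Finset.sum_add_distrib]
            refine Finset.sum_congr rfl fun x hx => ?_
            simp only [hbound, if_neg (show ¬ H + x < H by omega), Nat.add_sub_cancel_left]
      _ ≤ (Real.exp (-κ) * (a * (α * 2 ^ rA)) + W) + (b * (β * 2 ^ rB) + W) := by
          have := sum_range_boundary_le H W
          gcongr
      _ = _ := by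
          have hWR : (W : ℝ) = (1 / 2) ^ h * (2 * H) := by
            rw [← h2H', hW, show R = (R - h) + h by omega]
            push_cast
            rw [Nat.add_sub_cancel, pow_add, mul_comm, mul_assoc, ← mul_pow]
            norm_num
          rw [mul_left_comm (a : ℝ), hPA', mul_left_comm (b : ℝ), hPB', h2H', hWR]
          ring

/-! ### Iteration: small loss at mean one -/

lemma exp_neg_le_one_sub_half {y : ℝ} (h0 : 0 ≤ y) (h1 : y ≤ 1) : Real.exp (-y) ≤ 1 - y / 2 := by
  have h2 : 1 + y ≤ Real.exp y := by linarith [Real.add_one_le_exp y]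
  rw [Real.exp_neg]
  calc (Real.exp y)⁻¹ ≤ (1 + y)⁻¹ := by gcongr
    _ ≤ 1 - y / 2 := by
      rw [inv_le_iff_one_le_mul₀ (by linarith)]
      nlinarith

/-- Iterating `HasTowers.combine` starting from equally spaced points of height `2 ^ γ`. -/
lemma exists_hasTowers_iterate {c C γ h : ℕ} {m α : ℝ} (hα : 0 ≤ α) (hT : HasTowers c C 0 m α)
    (hh : 1 ≤ h) (hγ : 3 * C + h ≤ γ) (j : ℕ) :
    ∃ C', HasTowers (2 ^ γ) C' ((1 / 2) ^ γ * (1 / 2) ^ j)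
      ((1 - (1 / 2) ^ j) * m + (1 / 2) ^ j)
      ((1 - (1 / 2) ^ j - j * (1 / 2) ^ j / 8) * α + (1 / 2) ^ j + 4 * (1 / 2) ^ h) := by
  induction j with
  | zero =>
    refine ⟨γ, ?_⟩
    have := (hasTowers_multiples γ).mono (m' := 1) (α' := 1 + 4 * (1 / 2) ^ h) le_rfl
      (le_add_of_nonneg_right (by positivity))
    simpa using this
  | succ j ih =>
    obtain ⟨C', hC'⟩ := ih
    have hcomb := hT.combine hC' (by positivity) hh hγ
    -- The height `2 ^ γ` cancels the seed's density, so the gain does not depend on `γ`.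
    have hp : (2 : ℝ) ^ γ * ((1 / 2) ^ γ * (1 / 2) ^ j) / 4 = (1 / 2) ^ j / 4 := by
      rw [← mul_assoc, ← mul_pow]; norm_num
    have hj1 : ((1 : ℝ) / 2) ^ j ≤ 1 := pow_le_one₀ (by norm_num) (by norm_num)
    have hj0 : (0 : ℝ) ≤ (1 / 2) ^ j := by positivity
    have hexp := exp_neg_le_one_sub_half (y := (1 / 2) ^ j / 4) (by positivity) (by linarith)
    have hexp' := mul_le_mul_of_nonneg_right hexp hα
    rw [hp] at hcomb
    refine ⟨3 * (C + C') + h + 1, ?_⟩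
    have hd : ((1 : ℝ) / 2) ^ γ * (1 / 2) ^ (j + 1) = (1 / 2) ^ γ * (1 / 2) ^ j / 2 := by
      rw [pow_succ]; ring
    rw [hd]
    refine hcomb.mono (le_of_eq ?_) ?_
    · rw [pow_succ]; ring
    · rw [pow_succ ((1 : ℝ) / 2) j]
      push_cast
      nlinarith

lemma exists_hasTowers_step {C n : ℕ} {m α : ℝ} (hα : 0 ≤ α) (hT : HasTowers 0 C 0 m α)
    (hm : 0 ≤ m) :
    ∃ C', HasTowers 0 C' 0 (m + (1 / 2) ^ n)
      ((1 - n * (1 / 2) ^ n / 8) * α + 2 * (1 / 2) ^ n) := by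
  -- With `h = n + 2` the boundary cost `4 * 2^-h` is `2^-n`.
  obtain ⟨C', h⟩ := exists_hasTowers_iterate hα hT (h := n + 2) (by omega) le_rfl n
  refine ⟨C', (h.density_zero 0).mono ?_ ?_⟩
  · have : (0 : ℝ) ≤ (1 / 2) ^ n * m := by positivity
    linarith
  · have : (0 : ℝ) ≤ (1 / 2) ^ n * α := by positivity
    rw [pow_add]
    linarith

/-- The term `16 / n` is the fixed point of `x ↦ (1 - n * 2^-n / 8) * x + 2 * 2^-n`, so additive
errors do not accumulate. -/
lemma exists_hasTowers_level {n : ℕ} (hn : 0 < n) (l : ℕ) :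
    ∃ C, HasTowers 0 C 0 (l * (1 / 2) ^ n) ((1 - n * (1 / 2) ^ n / 8) ^ l + 16 / n) := by
  have hg : (n : ℝ) * (1 / 2) ^ n ≤ 1 := by
    have h1 : (n : ℝ) ≤ 2 ^ n := by exact_mod_cast Nat.lt_two_pow_self.le
    calc (n : ℝ) * (1 / 2) ^ n ≤ 2 ^ n * (1 / 2) ^ n := by gcongr
      _ = 1 := by rw [← mul_pow]; norm_num
  have hnR : (0 : ℝ) < n := by exact_mod_cast hn
  induction l with
  | zero =>
    exact ⟨0, hasTowers_zero.mono (by simp) (by rw [pow_zero]; linarith [div_pos (show (0 : ℝ) < 16 by norm_num) hnR])⟩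
  | succ l ih =>
    obtain ⟨C, hC⟩ := ih
    have hb : (0 : ℝ) ≤ 1 - n * (1 / 2) ^ n / 8 := by linarith
    obtain ⟨C', h⟩ := exists_hasTowers_step (n := n) (by positivity) hC (by positivity)
    refine ⟨C', h.mono (le_of_eq ?_) (le_of_eq ?_)⟩
    · push_cast; ring
    · field_simp
      ring

lemma exists_hasTowers_mean_one {ε : ℝ} (hε : 0 < ε) : ∃ C, HasTowers 0 C 0 1 ε := by
  obtain ⟨n, hn⟩ := exists_nat_gt (24 / ε)
  have hnR : (0 : ℝ) < n := lt_trans (by positivity) hn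
  have hn0 : 0 < n := by exact_mod_cast hnR
  obtain ⟨C, h⟩ := exists_hasTowers_level hn0 (2 ^ n)
  have h2 : ((2 ^ n : ℕ) : ℝ) * (1 / 2) ^ n = 1 := by
    push_cast; rw [← mul_pow]; norm_num
  refine ⟨C, h.mono h2.le ?_⟩
  have hg : (n : ℝ) * (1 / 2) ^ n ≤ 1 := by
    have h1 : (n : ℝ) ≤ (2 ^ n : ℕ) := by exact_mod_cast Nat.lt_two_pow_self.le
    calc (n : ℝ) * (1 / 2) ^ n ≤ (2 ^ n : ℕ) * (1 / 2) ^ n := by gcongr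
      _ = 1 := h2
  have h3 : (1 - n * (1 / 2) ^ n / 8 : ℝ) ^ (2 ^ n) ≤ 8 / n := by
    calc (1 - n * (1 / 2) ^ n / 8 : ℝ) ^ (2 ^ n)
        ≤ (Real.exp (-(n * (1 / 2) ^ n / 8))) ^ (2 ^ n) := by
          gcongr
          · linarith
          · exact Real.one_sub_le_exp_neg _
      _ = (Real.exp (n / 8))⁻¹ := by
          rw [← Real.exp_nat_mul, ← Real.exp_neg]
          congr 1
          linear_combination (-(n : ℝ) / 8) * h2
      _ ≤ (n / 8 : ℝ)⁻¹ := by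
          gcongr
          linarith [Real.add_one_le_exp ((n : ℝ) / 8)]
      _ = 8 / n := by rw [inv_div]
  have h4 : 24 / (n : ℝ) ≤ ε := by
    rw [div_lt_iff₀ hε] at hn
    rw [div_le_iff₀ hnR]
    linarith
  have h5 : (24 : ℝ) / n = 8 / n + 16 / n := by rw [← add_div]; norm_num
  linarith

/-- There are periodic functions of mean at most one for which, for at least half of the starting
points `x`, the number of `n ≥ 1` with `f (x + n) ≥ n / t` exceeds `K * t` for some `t ≥ 1`. -/
theorem exists_periodic_large_count (K : ℕ) :
    ∃ (P : ℕ) (f : ℕ → ℕ), 0 < P ∧ Function.Periodic f P ∧ ∑ x ∈ Finset.range P, f x ≤ P ∧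
      ∃ G ⊆ Finset.range P, P ≤ 2 * G.card ∧ ∀ x ∈ G, ∃ (t : ℕ) (A : Finset ℕ), 1 ≤ t ∧
        (∀ n ∈ A, 1 ≤ n ∧ n ≤ t * f (x + n)) ∧ K * t ≤ A.card := by
  obtain ⟨C, hC⟩ := exists_hasTowers_mean_one (ε := Real.exp (-K) / 2) (by positivity)
  obtain ⟨f, hf⟩ := hC C le_rfl
  obtain ⟨t, A, htA, hloss⟩ := hf.exists_hits
  have hmean := hf.mean_le
  refine ⟨2 ^ C, f, by positivity, hf.periodic, ?_,
    (Finset.range (2 ^ C)).filter (fun x => K * t x ≤ (A x).card), Finset.filter_subset _ _, ?_, ?_⟩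
  · rw [one_mul] at hmean
    exact_mod_cast hmean
  -- Markov's inequality: a bad point contributes at least `exp (-K)` to the loss.
  · have h1 : (((Finset.range (2 ^ C)).filter (fun x => ¬ K * t x ≤ (A x).card)).card : ℝ)
        * Real.exp (-K) ≤ Real.exp (-K) / 2 * 2 ^ C := by
      refine le_trans ?_ hloss
      rw [← nsmul_eq_mul, ← Finset.sum_const]
      refine le_trans ?_ (Finset.sum_le_sum_of_subset_of_nonneg
        (Finset.filter_subset (fun x => ¬ K * t x ≤ (A x).card) _)
        (fun x _ _ => (Real.exp_pos _).le))
      refine Finset.sum_le_sum fun x hx => ?_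
      obtain ⟨hx1, hx2⟩ := Finset.mem_filter.1 hx
      apply Real.exp_le_exp.2
      have htpos : 0 < t x := Nat.pos_of_ne_zero fun h0 => by rw [h0] at hx2; simp at hx2
      have htR : (0 : ℝ) < t x := by exact_mod_cast htpos
      rw [neg_le_neg_iff, div_le_iff₀ htR]
      exact_mod_cast (not_le.1 hx2).le
    have h2 : (((Finset.range (2 ^ C)).filter (fun x => ¬ K * t x ≤ (A x).card)).card : ℝ) * 2
        ≤ 2 ^ C := by
      have := Real.exp_pos (-(K : ℝ))
      refine le_of_mul_le_mul_right ?_ this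
      linarith
    have h3 := Finset.card_filter_add_card_filter_not (s := Finset.range (2 ^ C))
      (fun x => K * t x ≤ (A x).card)
    rw [Finset.card_range] at h3
    have h4 : ((Finset.range (2 ^ C)).filter (fun x => ¬ K * t x ≤ (A x).card)).card * 2 ≤ 2 ^ C := by
      exact_mod_cast h2
    omega
  · intro x hx
    obtain ⟨hx1, hx2⟩ := Finset.mem_filter.1 hx
    obtain ⟨h1, -, h3⟩ := htA x (Finset.mem_range.1 hx1)
    refine ⟨t x, A x, Nat.pos_of_ne_zero fun h0 => ?_, h3, hx2⟩
    rw [h0] at h1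
    simp at h1

/-! ### Bad weights and the Bernoulli shift -/

/-- Events of probability bounded below occur infinitely often with positive probability. -/
lemma not_ae_eventually_notMem {Ω : Type*} [MeasurableSpace Ω] {μ : Measure Ω}
    [IsProbabilityMeasure μ] {F : ℕ → Set Ω} {c : ℝ≥0∞}
    (hc : c < 1) (h : ∀ j, μ (F j)ᶜ ≤ c) : ¬ ∀ᵐ x ∂μ, ∀ᶠ j in atTop, x ∉ F j := by
  intro hae
  set G : ℕ → Set Ω := fun N => {x | ∀ j, N ≤ j → x ∉ F j} with hG
  have hmono : Monotone G := fun N M hNM x hx j hj => hx j (hNM.trans hj)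
  have hlim := tendsto_measure_iUnion_atTop (μ := μ) hmono
  have hone : μ (⋃ N, G N) = 1 := by
    rw [← measure_univ (μ := μ)]
    refine measure_congr (eventuallyEq_univ.2 ?_)
    filter_upwards [hae] with x hx
    obtain ⟨N, hN⟩ := eventually_atTop.1 hx
    exact Set.mem_iUnion.2 ⟨N, hN⟩
  rw [hone] at hlim
  have : (1 : ℝ≥0∞) ≤ c := le_of_tendsto' hlim fun N =>
    (measure_mono fun x (hx : x ∈ G N) => hx N le_rfl).trans (h N)
  exact absurd this (not_le.2 hc)

lemma exists_integrable_dominating {Ω : Type*} [MeasurableSpace Ω] {μ : Measure Ω}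
    {u : ℕ → Ω → ℝ≥0∞} (hu : ∀ j, Measurable (u j)) (hsum : ∑' j, ∫⁻ ω, u j ω ∂μ ≠ ∞) :
    ∃ g : Ω → ℝ, Measurable g ∧ Integrable g μ ∧ ∀ᵐ ω ∂μ, ∀ j, (u j ω).toReal ≤ g ω := by
  have hm : Measurable fun ω => ∑' j, u j ω := Measurable.tsum hu
  have hint : ∫⁻ ω, ∑' j, u j ω ∂μ ≠ ∞ := by
    rwa [lintegral_tsum fun j => (hu j).aemeasurable]
  refine ⟨fun ω => (∑' j, u j ω).toReal, hm.ennreal_toReal,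
    integrable_toReal_of_lintegral_ne_top hm.aemeasurable hint, ?_⟩
  filter_upwards [ae_lt_top hm hint] with ω hω j
  exact ENNReal.toReal_mono hω.ne (ENNReal.le_tsum j)

/-- The left shift on two-sided sequences. -/
def shiftEquiv (Ω : Type) [MeasurableSpace Ω] : (ℤ → Ω) ≃ᵐ (ℤ → Ω) where
  toFun y i := y (i + 1)
  invFun y i := y (i - 1)
  left_inv y := by ext i; simp
  right_inv y := by ext i; simp
  measurable_toFun := by
    simp only [Equiv.coe_fn_mk]
    fun_prop
  measurable_invFun := by
    simp only [Equiv.symm_mk, Equiv.coe_fn_mk]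
    fun_prop

lemma shiftEquiv_iterate {Ω : Type} [MeasurableSpace Ω] (n : ℕ) (y : ℤ → Ω) (i : ℤ) :
    (shiftEquiv Ω)^[n] y i = y (i + n) := by
  induction n generalizing y with
  | zero => simp
  | succ n ih =>
    rw [Function.iterate_succ_apply, ih]
    change y (i + n + 1) = _
    push_cast
    rw [add_assoc]

lemma measurePreserving_shiftEquiv {Ω : Type} [MeasurableSpace Ω] (μ : Measure Ω)
    [IsProbabilityMeasure μ] :
    MeasurePreserving (shiftEquiv Ω) (Measure.infinitePi fun _ : ℤ => μ)
      (Measure.infinitePi fun _ : ℤ => μ) := by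
  refine ⟨(shiftEquiv Ω).measurable, ?_⟩
  exact Measure.map_infinitePi_infinitePi_of_inj (P := fun _ : ℤ => μ)
    (f := fun i : ℤ => i + 1) (add_left_injective 1)

/-- A single integrable function on the unit interval whose tail is at least `1 / N j` at the level
`s j`, provided that `N j ≥ 2 ^ j * s j`. -/
lemma exists_integrable_tail_ge {s N : ℕ → ℕ} (hN0 : ∀ j, 0 < N j)
    (hN : ∀ j, 2 ^ j * s j ≤ N j) :
    ∃ g : unitInterval → ℝ, Measurable g ∧ Integrable g ∧
      ∀ j, ENNReal.ofReal (1 / N j) ≤ volume {u | (s j : ℝ) ≤ g u} := by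
  have hp : ∀ j, (1 / N j : ℝ) ∈ unitInterval := fun j => by
    have : (1 : ℝ) ≤ N j := by exact_mod_cast hN0 j
    exact ⟨by positivity, by rw [div_le_one (by positivity)]; exact this⟩
  set p : ℕ → unitInterval := fun j => ⟨1 / N j, hp j⟩ with hpdef
  have hvol : ∀ j, volume (Set.Iic (p j)) = ENNReal.ofReal (1 / N j) := fun j => by
    rw [unitInterval.volume_Iic]
  obtain ⟨g, hg, hgi, hdom⟩ := exists_integrable_dominating (μ := (volume : Measure unitInterval))
    (u := fun j => (Set.Iic (p j)).indicator fun _ => (s j : ℝ≥0∞))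
    (fun j => measurable_const.indicator measurableSet_Iic) (by
      refine ne_top_of_le_ne_top (b := ∑' j : ℕ, (2⁻¹ : ℝ≥0∞) ^ j) ?_
        (ENNReal.tsum_le_tsum fun j => ?_)
      · rw [ENNReal.tsum_geometric, ENNReal.one_sub_inv_two, inv_inv]
        exact ENNReal.ofNat_ne_top
      · rw [lintegral_indicator_const measurableSet_Iic, hvol]
        have hNR : (0 : ℝ) < N j := by exact_mod_cast hN0 j
        have h1 : (s j : ℝ) * (1 / N j) ≤ (2 ^ j)⁻¹ := by
          rw [mul_one_div, div_le_iff₀ hNR, inv_mul_eq_div, le_div_iff₀ (by positivity)]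
          have := hN j
          rw [mul_comm]
          exact_mod_cast this
        rw [← ENNReal.ofReal_natCast, ← ENNReal.ofReal_mul (by positivity), ENNReal.inv_pow.symm]
        refine (ENNReal.ofReal_le_ofReal h1).trans (le_of_eq ?_)
        rw [ENNReal.ofReal_inv_of_pos (by positivity), ENNReal.ofReal_pow (by norm_num)]
        simp)
  refine ⟨g, hg, hgi, fun j => ?_⟩
  rw [← hvol]
  refine measure_mono_ae ?_
  filter_upwards [hdom] with u hu hmem
  have := hu j
  rw [Set.indicator_of_mem (show u ∈ Set.Iic (p j) from hmem)] at this
  change (s j : ℝ) ≤ g u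
  simpa using this

lemma one_sub_inv_pow_le {N : ℕ} (hN : 0 < N) :
    ENNReal.ofReal (1 - 1 / N) ^ N ≤ ENNReal.ofReal (Real.exp (-1)) := by
  have hNR : (1 : ℝ) ≤ N := by exact_mod_cast hN
  have h0 : (0 : ℝ) ≤ 1 - 1 / N := by
    rw [sub_nonneg, div_le_one (by positivity)]; exact hNR
  rw [← ENNReal.ofReal_pow h0]
  apply ENNReal.ofReal_le_ofReal
  calc (1 - 1 / N : ℝ) ^ N ≤ (Real.exp (-(1 / N))) ^ N := by
        gcongr
        exact Real.one_sub_le_exp_neg _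
    _ = Real.exp (-1) := by
        rw [← Real.exp_nat_mul]
        congr 1
        field_simp

/-- If `a n ≥ n / s` for at least `2 ^ j * s` indices `n`, for suitable `s = s j ≥ 2 ^ j`, then the
weights `a` are bad for the tail of an integrable function along a Bernoulli shift. -/
theorem exists_system_not_tendsto {a : ℕ → ℝ} {s : ℕ → ℕ} {A : ℕ → Finset ℕ}
    (hs : ∀ j, 2 ^ j ≤ s j) (hA : ∀ j, ∀ n ∈ A j, 1 ≤ n ∧ (n : ℝ) ≤ s j * a n)
    (hcard : ∀ j, 2 ^ j * s j ≤ (A j).card) :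
    ∃ (Y : Type) (_ : MeasurableSpace Y) (ν : Measure Y) (_ : IsProbabilityMeasure ν)
      (S : Y ≃ᵐ Y) (g : Y → ℝ), MeasurePreserving S ν ν ∧ Integrable g ν ∧
        ¬ ∀ᵐ y ∂ν, Tendsto (fun n : ℕ => a n * g (S^[n] y) / (n : ℝ)) atTop (𝓝 0) := by
  have hspos : ∀ j, 0 < s j := fun j => lt_of_lt_of_le (by positivity) (hs j)
  have hcpos : ∀ j, 0 < (A j).card := fun j =>
    lt_of_lt_of_le (Nat.mul_pos (by positivity) (hspos j)) (hcard j)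
  obtain ⟨g, hgm, hgi, hgt⟩ := exists_integrable_tail_ge hcpos hcard
  set ν := Measure.infinitePi fun _ : ℤ => (volume : Measure unitInterval) with hν
  refine ⟨ℤ → unitInterval, inferInstance, ν, inferInstance, shiftEquiv unitInterval,
    fun y => g (y 0), measurePreserving_shiftEquiv _,
    (measurePreserving_eval_infinitePi (fun _ : ℤ => (volume : Measure unitInterval)) 0
      ).integrable_comp_of_integrable hgi, fun hae => ?_⟩
  set F : ℕ → Set (ℤ → unitInterval) := fun j => {y | ∃ n ∈ A j, (s j : ℝ) ≤ g (y n)} with hFdef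
  refine not_ae_eventually_notMem (μ := ν) (F := F) (c := ENNReal.ofReal (Real.exp (-1))) ?_ ?_ ?_
  · rw [← ENNReal.ofReal_one]
    exact (ENNReal.ofReal_lt_ofReal_iff one_pos).2 (Real.exp_lt_one_iff.2 (by norm_num))
  · intro j
    have hset : (F j)ᶜ = Set.pi (((A j).map Nat.castEmbedding : Finset ℤ) : Set ℤ)
        (fun _ => {u | (s j : ℝ) ≤ g u}ᶜ) := by
      ext y
      simp [hFdef, Set.mem_pi]
    have hm : MeasurableSet {u | (s j : ℝ) ≤ g u} := measurableSet_le measurable_const hgm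
    rw [hset, hν, Measure.infinitePi_pi _ (fun _ _ => hm.compl), Finset.prod_const,
      Finset.card_map, prob_compl_eq_one_sub hm]
    refine le_trans ?_ (one_sub_inv_pow_le (hcpos j))
    gcongr
    rw [ENNReal.ofReal_sub _ (by positivity), ENNReal.ofReal_one]
    exact tsub_le_tsub_left (hgt j) 1
  · filter_upwards [hae] with y hy
    simp only [shiftEquiv_iterate, zero_add] at hy
    obtain ⟨N, hN⟩ := eventually_atTop.1 (hy.eventually (gt_mem_nhds one_pos))
    -- Once `s j > M`, no success can occur at `n < N`, so a success would contradict the quotient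
    -- being below 1 from `N` on.
    obtain ⟨M, hM⟩ : ∃ M : ℕ, ∀ n < N, g (y n) ≤ M := by
      obtain ⟨M, hM⟩ := exists_nat_ge (∑ n ∈ Finset.range N, |g (y n)|)
      refine ⟨M, fun n hn => le_trans (le_trans (le_abs_self _) ?_) hM⟩
      exact Finset.single_le_sum (f := fun n : ℕ => |g (y n)|) (fun _ _ => abs_nonneg _)
        (Finset.mem_range.2 hn)
    filter_upwards [eventually_ge_atTop M] with j hj hmem
    obtain ⟨n, hn, hgn⟩ := hmem
    obtain ⟨hn1, hn2⟩ := hA j n hn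
    have hnR : (0 : ℝ) < n := by exact_mod_cast hn1
    have hsR : (0 : ℝ) < s j := by exact_mod_cast hspos j
    by_cases hnN : n < N
    · have h1 : M < s j := lt_of_lt_of_le (lt_of_le_of_lt hj Nat.lt_two_pow_self) (hs j)
      have h2 : (M : ℝ) < s j := by exact_mod_cast h1
      linarith [hM n hnN]
    · have h1 := hN n (not_lt.1 hnN)
      rw [div_lt_one hnR] at h1
      have ha : 0 < a n := by
        by_contra hneg
        have := mul_nonpos_of_nonneg_of_nonpos hsR.le (not_lt.1 hneg)
        linarith
      have h2 := mul_le_mul_of_nonneg_left hgn ha.le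
      linarith

/-! ### The product of cyclic rotations -/

/-- The normalized counting measure on `Fin P`. -/
noncomputable def uniformFin (P : ℕ) : Measure (Fin P) := (P : ℝ≥0∞)⁻¹ • Measure.count

lemma lintegral_uniformFin (P : ℕ) (φ : ℕ → ℝ≥0∞) :
    ∫⁻ i, φ i.val ∂uniformFin P = (P : ℝ≥0∞)⁻¹ * ∑ i ∈ Finset.range P, φ i := by
  rw [uniformFin, lintegral_smul_measure, lintegral_count, tsum_fintype, smul_eq_mul,
    Fin.sum_univ_eq_sum_range]

instance isProbabilityMeasure_uniformFin (P : ℕ) [NeZero P] :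
    IsProbabilityMeasure (uniformFin P) := by
  refine ⟨?_⟩
  have h := lintegral_uniformFin P (fun _ => 1)
  rw [lintegral_one] at h
  rw [h]
  simp only [Finset.sum_const, Finset.card_range, nsmul_eq_mul, mul_one]
  exact ENNReal.inv_mul_cancel (by exact_mod_cast NeZero.ne P) (ENNReal.natCast_ne_top P)

lemma measurePreserving_uniformFin {P : ℕ} (e : Equiv.Perm (Fin P)) :
    MeasurePreserving e (uniformFin P) (uniformFin P) := by
  refine ⟨measurable_from_top, ?_⟩
  rw [uniformFin, Measure.map_smul]
  congr 1
  ext s hs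
  rw [Measure.map_apply measurable_from_top hs, ← Equiv.image_symm_eq_preimage,
    Measure.count_injective_image e.symm.injective]

/-- The simultaneous rotation of a sequence of cyclic groups. -/
def cyclicRotation (P : ℕ → ℕ) : (∀ m, Fin (P m)) ≃ᵐ (∀ m, Fin (P m)) where
  toEquiv := Equiv.piCongrRight fun m => finRotate (P m)
  measurable_toFun := measurable_pi_lambda _ fun m =>
    Measurable.comp (g := finRotate (P m)) measurable_from_top (measurable_pi_apply m)
  measurable_invFun := measurable_pi_lambda _ fun m =>
    Measurable.comp (g := (finRotate (P m)).symm) measurable_from_top (measurable_pi_apply m)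

lemma measurePreserving_cyclicRotation (P : ℕ → ℕ) [∀ m, NeZero (P m)] :
    MeasurePreserving (cyclicRotation P) (Measure.infinitePi fun m => uniformFin (P m))
      (Measure.infinitePi fun m => uniformFin (P m)) := by
  refine ⟨(cyclicRotation P).measurable, ?_⟩
  have h := Measure.infinitePi_map_pi (fun m => uniformFin (P m))
    (f := fun m => finRotate (P m)) (fun m => measurable_from_top)
  simp only [(measurePreserving_uniformFin _).map_eq] at h
  exact h

lemma cyclicRotation_iterate_val (P : ℕ → ℕ) [∀ m, NeZero (P m)] (n m : ℕ)
    (x : ∀ m, Fin (P m)) :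
    ((cyclicRotation P)^[n] x m).val = ((x m).val + n) % P m := by
  induction n with
  | zero => simp [Nat.mod_eq_of_lt]
  | succ n ih =>
    rw [Function.iterate_succ_apply']
    change (finRotate (P m) ((cyclicRotation P)^[n] x m)).val = _
    rw [finRotate_apply, Fin.val_add, ih, Fin.val_one', ← Nat.add_mod, add_assoc]

lemma lintegral_cyclic_coordinate (P : ℕ → ℕ) [∀ m, NeZero (P m)] (m : ℕ) (φ : ℕ → ℝ≥0∞) :
    ∫⁻ x, φ (x m).val ∂(Measure.infinitePi fun m => uniformFin (P m)) =
      (P m : ℝ≥0∞)⁻¹ * ∑ i ∈ Finset.range (P m), φ i := by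
  rw [← lintegral_uniformFin]
  exact (measurePreserving_eval_infinitePi (fun m => uniformFin (P m)) m).lintegral_comp
    (f := fun i => φ i.val) measurable_from_top

lemma measure_cyclic_coordinate_notMem_le (P : ℕ → ℕ) [∀ m, NeZero (P m)] (m : ℕ) {G : Finset ℕ}
    (hG : G ⊆ Finset.range (P m)) (hcard : P m ≤ 2 * G.card) :
    (Measure.infinitePi fun m => uniformFin (P m)) {x | (x m).val ∈ G}ᶜ ≤ 2⁻¹ := by
  have hm : MeasurableSet {x : ∀ m, Fin (P m) | (x m).val ∈ G}ᶜ := by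
    have hs : MeasurableSet {i : Fin (P m) | i.val ∈ G}ᶜ := MeasurableSet.of_discrete
    exact hs.preimage (measurable_pi_apply m)
  have h := lintegral_cyclic_coordinate P m (fun i => if i ∈ G then 0 else 1)
  have h2 : ∫⁻ x, (if (x m).val ∈ G then (0 : ℝ≥0∞) else 1)
      ∂(Measure.infinitePi fun m => uniformFin (P m)) =
      (Measure.infinitePi fun m => uniformFin (P m)) {x | (x m).val ∈ G}ᶜ := by
    rw [← lintegral_indicator_one hm]
    refine lintegral_congr fun x => ?_
    by_cases hx : (x m).val ∈ G <;> simp [hx]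
  rw [← h2, h]
  have h3 : ∑ i ∈ Finset.range (P m), (if i ∈ G then (0 : ℝ≥0∞) else 1)
      = ((Finset.range (P m) \ G).card : ℝ≥0∞) := by
    rw [← Finset.filter_notMem_eq_sdiff, Finset.card_filter]
    push_cast
    exact Finset.sum_congr rfl fun i _ => by by_cases hi : i ∈ G <;> simp [hi]
  rw [h3, mul_comm, ← div_eq_mul_inv, ENNReal.div_le_iff_le_mul (Or.inr (by simp))
    (Or.inr (by simp)), ← ENNReal.div_eq_inv_mul,
    ENNReal.le_div_iff_mul_le (Or.inl (by simp)) (Or.inl (by simp))]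
  have h4 := Finset.card_sdiff_add_card_eq_card hG
  rw [Finset.card_range] at h4
  exact_mod_cast (by omega : (Finset.range (P m) \ G).card * 2 ≤ P m)

theorem theorem2 :
    ∃ (X : Type) (_ : MeasurableSpace X) (μ : Measure X) (_ : IsProbabilityMeasure μ)
      (T : X ≃ᵐ X), MeasurePreserving T μ μ ∧ ¬ ReturnTimesForTheTail μ T 1 := by
  -- Of the factor `4 ^ m`, one `2 ^ m` pays for the summability weight `2^-m` and the other makes
  -- the counts unbounded.
  choose P f hP hper hmean G hG hGcard hhits using fun m => exists_periodic_large_count (4 ^ m)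
  have : ∀ m, NeZero (P m) := fun m => ⟨(hP m).ne'⟩
  set μ := Measure.infinitePi fun m => uniformFin (P m) with hμ
  have hT := measurePreserving_cyclicRotation P
  refine ⟨∀ m, Fin (P m), inferInstance, μ, inferInstance, cyclicRotation P, hT, fun hRT => ?_⟩
  obtain ⟨F, -, hFi, hdom⟩ := exists_integrable_dominating (μ := μ)
    (u := fun m x => (2⁻¹ : ℝ≥0∞) ^ m * (f m (x m).val : ℝ≥0∞))
    (fun m => Measurable.comp (g := fun i : Fin (P m) => (2⁻¹ : ℝ≥0∞) ^ m * (f m i.val : ℝ≥0∞))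
      measurable_from_top (measurable_pi_apply m)) (by
      refine ne_top_of_le_ne_top (b := ∑' j : ℕ, (2⁻¹ : ℝ≥0∞) ^ j) ?_
        (ENNReal.tsum_le_tsum fun m => ?_)
      · rw [ENNReal.tsum_geometric, ENNReal.one_sub_inv_two, inv_inv]
        exact ENNReal.ofNat_ne_top
      · rw [lintegral_cyclic_coordinate P m (fun i => (2⁻¹ : ℝ≥0∞) ^ m * (f m i : ℝ≥0∞)),
          ← Finset.mul_sum, mul_left_comm]
        refine mul_le_of_le_one_right' ?_
        rw [← ENNReal.div_eq_inv_mul]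
        refine ENNReal.div_le_of_le_mul ?_
        rw [one_mul]
        exact_mod_cast hmean m)
  have hdomT : ∀ᵐ x ∂μ, ∀ n m : ℕ,
      (1 / 2 : ℝ) ^ m * f m ((x m).val + n) ≤ F ((cyclicRotation P)^[n] x) := by
    rw [ae_all_iff]
    intro n
    filter_upwards [(hT.iterate n).quasiMeasurePreserving.ae hdom] with x hx m
    have := hx m
    rw [cyclicRotation_iterate_val, (hper m).map_mod_nat] at this
    simpa using this
  refine not_ae_eventually_notMem (μ := μ) (F := fun m => {x | (x m).val ∈ G m}) (c := 2⁻¹)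
    (by simp) (fun m => measure_cyclic_coordinate_notMem_le P m (hG m) (hGcard m)) ?_
  filter_upwards [hRT F (memLp_one_iff_integrable.2 hFi), hdomT] with x hx hxF
  by_contra hnot
  have hfreq : ∃ᶠ m in atTop, (x m).val ∈ G m := by
    simpa [Filter.Frequently] using hnot
  rw [frequently_atTop] at hfreq
  choose M hMj hMG using hfreq
  choose t A ht hA hAcard using fun j => hhits (M j) _ (hMG j)
  -- The weight `2^-M` turns the time `t` into the level `s = 2 ^ M * t`; `j ≤ M j` then gives `2 ^
  -- j * s ≤ 4 ^ M * t`.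
  obtain ⟨Y, mY, ν, hν, S, g, hS, hg, hbad⟩ := exists_system_not_tendsto
    (a := fun n => F ((cyclicRotation P)^[n] x)) (s := fun j => 2 ^ M j * t j) (A := A)
    (fun j => le_trans (Nat.pow_le_pow_right (by norm_num) (hMj j))
      (Nat.le_mul_of_pos_right _ (ht j)))
    (fun j n hn => ⟨(hA j n hn).1, by
      have h1 : (n : ℝ) ≤ t j * f (M j) ((x (M j)).val + n) := by exact_mod_cast (hA j n hn).2
      have h2 := mul_le_mul_of_nonneg_left (hxF n (M j))
        (show (0 : ℝ) ≤ ((2 ^ M j * t j : ℕ) : ℝ) by positivity)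
      refine h1.trans (le_trans (le_of_eq ?_) h2)
      push_cast
      have h3 : (2 : ℝ) ^ M j * (1 / 2) ^ M j = 1 := by rw [← mul_pow]; norm_num
      linear_combination (-(t j : ℝ) * f (M j) ((x (M j)).val + n)) * h3⟩)
    (fun j => by
      refine le_trans ?_ (hAcard j)
      rw [← mul_assoc]
      gcongr
      calc 2 ^ j * 2 ^ M j ≤ 2 ^ M j * 2 ^ M j := by
            gcongr
            · norm_num
            · exact hMj j
        _ = 4 ^ M j := by rw [← mul_pow]; norm_num)
  exact hbad (hx Y ν S hS g hg)
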